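/- A stochastic graph $G=(U,V,E)$ has finite sets $U$ (offline vertices) and $V$ (online vertices), $E=U\times V$, edge probabilities $p_{u,v}\in[0,1]$, arbitrary real edge weights $w_{u,v}$, and patience values $\ell_v\in\mathbb{N}$ for $v\in V$. The edges are active independently, $(u,v)$ with probability $p_{u,v}$, and the state of an edge is revealed by probing it. Committal benchmark. $\mathrm{OPT}(G)$ is the largest expected weight of the matching built by an adaptive (possibly randomized) probing algorithm which knows $G$, may probe edges in any order, makes at most $\ell_v$ probes to edges at each $v\in V$, and must add a probed edge that is found active to the current matching whenever both its endpoints are unmatched. Linear program. Let $U^{(\le k)}$ be the set of tuples of length between $1$ and $k$ of distinct elements of $U$. For $\mathbf{u}=(u_1,\dots,u_m)\in U^{(\le \ell_v)}$ put $g_v^i(\mathbf{u})=p_{u_i,v}\prod_{j<i}(1-p_{u_j,v})$. Consider the linear program that maximizes $$\sum_{v\in V}\sum_{\mathbf{u}\in U^{(\le \ell_v)}}\Big(\sum_{i=1}^{|\mathbf{u}|}w_{u_i,v}\,g_v^i(\mathbf{u})\Big)x_v(\mathbf{u})$$ subject to $\sum_{v\in V}\sum_{\mathbf{u}\in U^{(\le\ell_v)}}\sum_{i:\,u_i=u}g_v^i(\mathbf{u})\,x_v(\mathbf{u})\le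 1$ for all $u\in U$, $\sum_{\mathbf{u}\in U^{(\le \ell_v)}}x_v(\mathbf{u})\le 1$ for all $v\in V$, and $x_v(\mathbf{u})\ge 0$. Algorithm. Fix an optimal solution $x$ of the linear program and start with $\mathcal{M}=\emptyset$. The vertices of $V$ arrive in a uniformly random order. When $v$ arrives, draw, independently of everything else, a tuple $\mathbf{u}\in U^{(\le\ell_v)}$ with probability $x_v(\mathbf{u})$ each, or pass (do nothing for $v$) with probability $1-\sum_{\mathbf{u}}x_v(\mathbf{u})$. If a tuple is drawn, probe $(u_1,v),(u_2,v),\dots$ in order until the first active edge $(u_i,v)$ is found, if any; if it is found and $u_i$ is unmatched, add $(u_i,v)$ to $\mathcal{M}$. Theorem. For every stochastic graph $G$ and every optimal solution $x$ of the linear program, the matching $\mathcal{M}$ returned by the algorithm satisfies $$\mathbb{E}[\mathrm{val}(\mathcal{M})]\ \ge\ \tfrac12\,\mathrm{OPT}(G),$$ where $\mathrm{val}$ is the total weight. Moreover the constant $\tfrac12$ is tight, so that the competitive ratio of the algorithm is exactly $\tfrac12$: for every $c>\tfrac12$ there is a stochastic graph $G$ with one offline vertex, two online vertices, nonnegative edge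 weights and $\mathrm{OPT}(G)>0$ such that $\mathbb{E}[\mathrm{val}(\mathcal{M})]<c\cdot\mathrm{OPT}(G)$ for every optimal solution $x$ of the linear program. -/

import Mathlib

/-- A (bipartite) stochastic graph with offline vertices `U`, online vertices `V` and edge set
`U × V` (a pair is excluded by giving it probability `0`): edge probabilities, edge weights, and
a patience parameter for each online vertex. -/
structure StochasticGraph (U V : Type*) where
  /-- The probability that the edge `(u, v)` is active. -/
  p : U → V → ℝ
  /-- The weight of the edge `(u, v)`. -/
  w : U → V → ℝ
  /-- The patience of `v`: the largest number of probes that may be made to edges at `v`. -/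
  patience : V → ℕ
  p_nonneg : ∀ u v, 0 ≤ p u v
  p_le_one : ∀ u v, p u v ≤ 1

/-- The set of nonempty tuples of length at most `k` of pairwise distinct elements of `U`. -/
abbrev Tuple (U : Type*) (k : ℕ) : Type _ :=
  {l : List U // l.Nodup ∧ l ≠ [] ∧ l.length ≤ k}

noncomputable instance Tuple.instFintype (U : Type*) [Fintype U] [DecidableEq U] (k : ℕ) :
    Fintype (Tuple U k) :=
  Fintype.ofInjective (fun t => (⟨t.1, t.2.1⟩ : {l : List U // l.Nodup}))
    (fun _ _ h => Subtype.ext (congrArg (fun c : {l : List U // l.Nodup} => c.1) h))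

/-- Add the edge `(u, v)` to the matching `M` if `u` and `v` are both unmatched, and leave `M`
unchanged otherwise. A matching is recorded by the partner, if any, of each online vertex. -/
def addEdge {U V : Type*} [DecidableEq U] [Fintype V] [DecidableEq V]
    (M : V → Option U) (u : U) (v : V) : V → Option U :=
  if M v = none ∧ ∀ s, M s ≠ some u then Function.update M v (some u) else M

/-- An adaptive (offline) probing algorithm, as a decision tree. At each node it either halts, or
probes some edge `(u, v)` and continues according to whether the edge turned out to be active or
inactive, or flips a coin that shows heads with probability `q` and continues according to the
result. -/
inductive ProbingAlgorithm (U V : Type*) where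
  | halt : ProbingAlgorithm U V
  | probe (u : U) (v : V) (ifActive ifInactive : ProbingAlgorithm U V) : ProbingAlgorithm U V
  | coin (q : Set.Icc (0 : ℝ) 1) (heads tails : ProbingAlgorithm U V) : ProbingAlgorithm U V

/-- The largest number of probes to edges at `v` that are made on a path of the decision tree. -/
def ProbingAlgorithm.maxProbes {U V : Type*} [DecidableEq V] (v : V) :
    ProbingAlgorithm U V → ℕ
  | .halt => 0
  | .probe _ s A B => (if s = v then 1 else 0) + max (A.maxProbes v) (B.maxProbes v)
  | .coin _ A B => max (A.maxProbes v) (B.maxProbes v)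

namespace StochasticGraph

variable {U V : Type*} [Fintype U] [DecidableEq U] [Fintype V] [DecidableEq V]

/-- The weight of a matching. -/
def matchingValue (G : StochasticGraph U V) (M : V → Option U) : ℝ :=
  ∑ v, (M v).elim 0 (fun u => G.w u v)

/-- The probability of the edge states `st` (`true` for active): they are independent, and
`st u v` is Bernoulli with parameter `p u v`. -/
def stateProb (G : StochasticGraph U V) (st : U → V → Bool) : ℝ :=
  ∏ u, ∏ v, if st u v then G.p u v else 1 - G.p u v

/-! ### The committal benchmark -/

/-- The value (averaged over the coin flips) of the matching that is built by a probing algorithm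
started from the matching `M` when the edge states are `st`. The algorithm is committal: an edge
that is probed and found active is added to the matching whenever this is possible. -/
def runValue (G : StochasticGraph U V) (st : U → V → Bool) :
    ProbingAlgorithm U V → (V → Option U) → ℝ
  | .halt, M => G.matchingValue M
  | .probe u v A B, M =>
      if st u v then G.runValue st A (addEdge M u v) else G.runValue st B M
  | .coin q A B, M => q.1 * G.runValue st A M + (1 - q.1) * G.runValue st B M

/-- The expected value of the matching built by a probing algorithm, started from the empty
matching. -/
def expectedValue (G : StochasticGraph U V) (A : ProbingAlgorithm U V) : ℝ :=
  ∑ st : U → V → Bool, G.stateProb st * G.runValue st A (fun _ => none)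

/-- The algorithm never makes more than `patience v` probes to edges at `v`. -/
def RespectsPatience (G : StochasticGraph U V) (A : ProbingAlgorithm U V) : Prop :=
  ∀ v, A.maxProbes v ≤ G.patience v

/-- The committal benchmark `OPT(G)`: the largest expected value that a probing algorithm
respecting commitment and patience attains. -/
noncomputable def OPT (G : StochasticGraph U V) : ℝ :=
  ⨆ A : {A : ProbingAlgorithm U V // G.RespectsPatience A}, G.expectedValue A.1

/-- `OPT` is a supremum of a set of reals that is bounded above. -/
theorem bddAbove_expectedValue (G : StochasticGraph U V) :
    BddAbove (Set.range
      fun A : {A : ProbingAlgorithm U V // G.RespectsPatience A} => G.expectedValue A.1) := by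
  set C : ℝ := ∑ v, ∑ u, |G.w u v| with hC
  have hM : ∀ M, G.matchingValue M ≤ C := by
    intro M
    refine Finset.sum_le_sum fun v _ => ?_
    cases h : M v with
    | none => simpa using Finset.sum_nonneg fun u _ => abs_nonneg (G.w u v)
    | some u =>
      exact (le_abs_self _).trans
        (Finset.single_le_sum (f := fun u => |G.w u v|) (fun u _ => abs_nonneg _)
          (Finset.mem_univ u))
  have hrun : ∀ (st : U → V → Bool) (A : ProbingAlgorithm U V) (M : V → Option U),
      G.runValue st A M ≤ C := by
    intro st A
    induction A with
    | halt => exact hM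
    | probe u v A B ihA ihB =>
      intro M
      simp only [runValue]
      split_ifs
      exacts [ihA _, ihB _]
    | coin q A B ihA ihB =>
      intro M
      simp only [runValue]
      nlinarith [ihA M, ihB M, q.2.1, q.2.2]
  refine ⟨∑ st : U → V → Bool, G.stateProb st * C, ?_⟩
  rintro _ ⟨A, rfl⟩
  refine Finset.sum_le_sum fun st _ => mul_le_mul_of_nonneg_left (hrun _ _ _) ?_
  refine Finset.prod_nonneg fun u _ => Finset.prod_nonneg fun v _ => ?_
  split_ifs
  exacts [G.p_nonneg u v, sub_nonneg.2 (G.p_le_one u v)]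

/-! ### The linear program -/

/-- `g v l i` is the probability that `(lᵢ, v)` is the first active edge when the edges between
`v` and the entries of `l` are revealed in order. -/
def g (G : StochasticGraph U V) (v : V) (l : List U) (i : Fin l.length) : ℝ :=
  G.p (l.get i) v * ∏ j ∈ Finset.univ.filter (fun j => j < i), (1 - G.p (l.get j) v)

/-- An assignment of values to the variables `x v t`, `t` a tuple of length at most
`patience v`. -/
abbrev LPVar (G : StochasticGraph U V) : Type _ := (v : V) → Tuple U (G.patience v) → ℝ

/-- The objective function of the linear program. -/
noncomputable def lpObjective (G : StochasticGraph U V) (x : G.LPVar) : ℝ :=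
  ∑ v, ∑ t : Tuple U (G.patience v),
    (∑ i : Fin t.1.length, G.w (t.1.get i) v * G.g v t.1 i) * x v t

/-- The constraints of the linear program. -/
structure LPFeasible (G : StochasticGraph U V) (x : G.LPVar) : Prop where
  offline : ∀ u, ∑ v, ∑ t : Tuple U (G.patience v),
    ∑ i ∈ Finset.univ.filter (fun i : Fin t.1.length => t.1.get i = u), G.g v t.1 i * x v t ≤ 1
  online : ∀ v, ∑ t, x v t ≤ 1
  nonneg : ∀ v t, 0 ≤ x v t

/-- Optimal solutions of the linear program. -/
def LPOptimal (G : StochasticGraph U V) (x : G.LPVar) : Prop :=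
  G.LPFeasible x ∧ ∀ y : G.LPVar, G.LPFeasible y → G.lpObjective y ≤ G.lpObjective x

/-- The linear program always has an optimal solution. -/
theorem exists_lpOptimal (G : StochasticGraph U V) : ∃ x : G.LPVar, G.LPOptimal x := by
  have hcompact : IsCompact {x : G.LPVar | G.LPFeasible x} := by
    refine IsCompact.of_isClosed_subset
      (isCompact_univ_pi fun v => isCompact_univ_pi fun _ => isCompact_Icc (a := (0 : ℝ)) (b := 1))
      ?_ ?_
    · have : {x : G.LPVar | G.LPFeasible x} =
          (⋂ u, {x : G.LPVar | ∑ v, ∑ t : Tuple U (G.patience v),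
            ∑ i ∈ Finset.univ.filter (fun i : Fin t.1.length => t.1.get i = u),
              G.g v t.1 i * x v t ≤ 1}) ∩
          ((⋂ v, {x : G.LPVar | ∑ t, x v t ≤ 1}) ∩
            ⋂ v, ⋂ t, {x : G.LPVar | 0 ≤ x v t}) := by
        ext x
        simp only [Set.mem_inter_iff, Set.mem_iInter, Set.mem_ofPred_eq]
        exact ⟨fun h => ⟨h.offline, h.online, h.nonneg⟩, fun h => ⟨h.1, h.2.1, h.2.2⟩⟩
      rw [this]
      refine (isClosed_iInter fun u => isClosed_le (by fun_prop) continuous_const).inter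
        ((isClosed_iInter fun v => isClosed_le (by fun_prop) continuous_const).inter
          (isClosed_iInter fun v => isClosed_iInter fun t =>
            isClosed_le continuous_const (by fun_prop)))
    · intro x hx v _ t _
      exact ⟨hx.nonneg v t, (Finset.single_le_sum (f := x v) (fun t _ => hx.nonneg v t)
        (Finset.mem_univ t)).trans (hx.online v)⟩
  have hne : {x : G.LPVar | G.LPFeasible x}.Nonempty :=
    ⟨fun _ _ => 0, ⟨fun u => by simp, fun v => by simp, fun v t => le_rfl⟩⟩
  have hcont : Continuous G.lpObjective := by
    unfold lpObjective
    fun_prop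
  obtain ⟨x, hx, hmax⟩ := hcompact.exists_isMaxOn hne hcont.continuousOn
  exact ⟨x, hx, fun y hy => hmax hy⟩

/-! ### The online algorithm -/

/-- The distribution of the tuple drawn by `VertexProbe` at `v`: the tuple `t` is drawn with
probability `x v t`, and with the remaining probability the algorithm passes (`none`). -/
noncomputable def drawProb (G : StochasticGraph U V) (x : G.LPVar) (v : V) :
    Option (Tuple U (G.patience v)) → ℝ
  | none => 1 - ∑ t, x v t
  | some t => x v t

/-- The offline vertex returned by `VertexProbe` at `v`, given the edge states and the drawn
tuple: the edges between `v` and the entries of the tuple are probed in order until one is found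
active, which is then returned. -/
def vertexProbe (G : StochasticGraph U V) (st : U → V → Bool) (v : V)
    (d : Option (Tuple U (G.patience v))) : Option U :=
  d.bind (fun t => t.1.find? (fun u => st u v))

/-- Processing the arrival of `v` with current matching `M`: if `VertexProbe` returns `u` and `u`
is unmatched, then `v` is matched to `u`. -/
def processArrival (G : StochasticGraph U V) (st : U → V → Bool)
    (d : (v : V) → Option (Tuple U (G.patience v))) (M : V → Option U) (v : V) : V → Option U :=
  (G.vertexProbe st v (d v)).elim M (fun u => addEdge M u v)

/-- The matching returned by the online algorithm, given the arrival order `π`, the edge states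
`st` and the tuples `d` drawn by the executions of `VertexProbe`. -/
def onlineMatching (G : StochasticGraph U V) (π : Fin (Fintype.card V) ≃ V)
    (st : U → V → Bool) (d : (v : V) → Option (Tuple U (G.patience v))) : V → Option U :=
  (List.ofFn π).foldl (G.processArrival st d) (fun _ => none)

/-- The expected value of the matching returned by the online algorithm that uses the solution
`x` of the linear program, in the random order model: the arrival order is uniformly random, and
the arrival order, the edge states, and the draws made at the vertices of `V` are independent. -/
noncomputable def romExpectedValue (G : StochasticGraph U V) (x : G.LPVar) : ℝ :=
  (∑ π : Fin (Fintype.card V) ≃ V, ∑ st : U → V → Bool,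
      ∑ d : (v : V) → Option (Tuple U (G.patience v)),
        G.stateProb st * (∏ v, G.drawProb x v (d v)) *
          G.matchingValue (G.onlineMatching π st d)) /
    (Fintype.card (Fin (Fintype.card V) ≃ V) : ℝ)

end StochasticGraph

/-! Everything is reduced to marginals: `z v u` is the probability that `v` obtains `u`. At a fixed
`v`, the marginals attainable by randomly drawing a tuple, or passing, form the polytope
`marginalPolytope`, so the linear program maximizes `∑ w u v * z v u` over `z v` in these polytopes
with `∑ v, z v u ≤ 1`.

Upper bound on the benchmark. Seen from a single `v`, a probe elsewhere is only a coin flip, while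
commitment makes the first active edge from `v` to an unmatched vertex the edge that `v` keeps.
Hence the marginals at `v` of any adaptive algorithm are those of a random tuple
(`matchProb_mem_marginalPolytope`); no offline vertex is matched twice, so they are feasible, and
the LP value is at least `OPT` (`LPOptimal.OPT_le`).

Lower bound on the algorithm. The vertices returned at distinct `v` are independent with the LP
marginals (`onlineExp_prod`). A returned `u` is lost only if an earlier `v'` also returned `u`. Each
`v'` precedes `v` with probability 1/2, so a union bound gives a matching probability of at least `z
v u * (1 - 1/2 * ∑ v' ≠ v, z v' u) ≥ z v u / 2`. Edges of negative weight do not interfere, since an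
optimal solution gives them marginal zero (`LPOptimal.marginal_eq_zero`).

Tightness. A certain edge of weight `ε ^ 2` competes with an edge of weight 1 that is active with
probability `ε`. The LP fills the capacity left by the second edge with the first, which then blocks
about half of the valuable matches. -/

set_option linter.unusedSectionVars false

/-! ### Expectations over independent Bernoulli variables -/

/-- The expectation of `f` under the product of the Bernoulli distributions with parameters `p`. -/
def bernoulliExp {ι : Type*} [Fintype ι] [DecidableEq ι] (p : ι → ℝ) (f : (ι → Bool) → ℝ) : ℝ :=
  ∑ s : ι → Bool, (∏ i, if s i then p i else 1 - p i) * f s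

section Bernoulli

variable {ι : Type*} [Fintype ι] [DecidableEq ι]

/-- The weight of each outcome is affine in `p i`, and conditioning on the state of `i` amounts to
setting `p i` to 1 or 0. Revealing edges thus stays within product measures, which lets inductions
generalize over `p`. -/
theorem bernoulliExp_split (p : ι → ℝ) (f : (ι → Bool) → ℝ) (i : ι) :
    bernoulliExp p f = p i * bernoulliExp (Function.update p i 1) f +
      (1 - p i) * bernoulliExp (Function.update p i 0) f := by
  unfold bernoulliExp
  rw [Finset.mul_sum, Finset.mul_sum, ← Finset.sum_add_distrib]
  refine Finset.sum_congr rfl fun s _ => ?_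
  have key : ∀ q : ι → ℝ, (∀ j, j ≠ i → q j = p j) →
      (∏ j, if s j then q j else 1 - q j) =
        (if s i then q i else 1 - q i) *
          ∏ j ∈ Finset.univ.erase i, if s j then p j else 1 - p j := by
    intro q hq
    rw [← Finset.mul_prod_erase _ _ (Finset.mem_univ i)]
    congr 1
    refine Finset.prod_congr rfl fun j hj => ?_
    rw [hq j (Finset.ne_of_mem_erase hj)]
  rw [key p fun _ _ => rfl, key (Function.update p i 1) fun j hj => Function.update_of_ne hj _ _,
    key (Function.update p i 0) fun j hj => Function.update_of_ne hj _ _]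
  cases s i <;> simp <;> ring

theorem bernoulliExp_congr_of_one {p : ι → ℝ} {f f' : (ι → Bool) → ℝ} (i : ι) (hp : p i = 1)
    (h : ∀ s, s i = true → f s = f' s) : bernoulliExp p f = bernoulliExp p f' := by
  refine Finset.sum_congr rfl fun s _ => ?_
  by_cases hs : s i = true
  · rw [h s hs]
  · rw [Finset.prod_eq_zero (Finset.mem_univ i) (by simp [hs, hp]), zero_mul, zero_mul]

theorem bernoulliExp_congr_of_zero {p : ι → ℝ} {f f' : (ι → Bool) → ℝ} (i : ι) (hp : p i = 0)
    (h : ∀ s, s i = false → f s = f' s) : bernoulliExp p f = bernoulliExp p f' := by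
  refine Finset.sum_congr rfl fun s _ => ?_
  by_cases hs : s i = true
  · rw [Finset.prod_eq_zero (Finset.mem_univ i) (by simp [hs, hp]), zero_mul, zero_mul]
  · rw [h s (by simpa using hs)]

/-- Reveal the state of `i` first. -/
theorem bernoulliExp_reveal (p : ι → ℝ) (i : ι) {f f₁ f₀ : (ι → Bool) → ℝ}
    (h₁ : ∀ s, s i = true → f s = f₁ s) (h₀ : ∀ s, s i = false → f s = f₀ s) :
    bernoulliExp p f = p i * bernoulliExp (Function.update p i 1) f₁ +
      (1 - p i) * bernoulliExp (Function.update p i 0) f₀ := by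
  rw [bernoulliExp_split p f i,
    bernoulliExp_congr_of_one i (Function.update_self i 1 p) h₁,
    bernoulliExp_congr_of_zero i (Function.update_self i 0 p) h₀]

theorem bernoulliExp_const (p : ι → ℝ) (c : ℝ) : bernoulliExp p (fun _ => c) = c := by
  have h := Finset.prod_univ_sum (fun _ : ι => (Finset.univ : Finset Bool))
    (fun i b => if b = true then p i else 1 - p i)
  rw [Fintype.piFinset_univ] at h
  unfold bernoulliExp
  rw [← Finset.sum_mul, ← h]
  simp

theorem bernoulliExp_add (p : ι → ℝ) (f f' : (ι → Bool) → ℝ) :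
    bernoulliExp p (fun s => f s + f' s) = bernoulliExp p f + bernoulliExp p f' := by
  simp only [bernoulliExp, mul_add, Finset.sum_add_distrib]

theorem bernoulliExp_const_mul (p : ι → ℝ) (c : ℝ) (f : (ι → Bool) → ℝ) :
    bernoulliExp p (fun s => c * f s) = c * bernoulliExp p f := by
  simp only [bernoulliExp, Finset.mul_sum, mul_left_comm]

theorem bernoulliExp_sum {κ : Type*} (K : Finset κ) (p : ι → ℝ) (f : κ → (ι → Bool) → ℝ) :
    bernoulliExp p (fun s => ∑ k ∈ K, f k s) = ∑ k ∈ K, bernoulliExp p (f k) := by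
  simp only [bernoulliExp, Finset.mul_sum]
  exact Finset.sum_comm

theorem bernoulliExp_mono {p : ι → ℝ} (hp0 : ∀ i, 0 ≤ p i) (hp1 : ∀ i, p i ≤ 1)
    {f f' : (ι → Bool) → ℝ} (h : ∀ s, f s ≤ f' s) : bernoulliExp p f ≤ bernoulliExp p f' := by
  refine Finset.sum_le_sum fun s _ => mul_le_mul_of_nonneg_left (h s) ?_
  refine Finset.prod_nonneg fun i _ => ?_
  split_ifs
  exacts [hp0 i, sub_nonneg.2 (hp1 i)]

end Bernoulli

/-! ### Marginals of probing a tuple at one online vertex -/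

/-- The entry at `u` is the probability that `u` is the first active entry of the list, when the
entries are active independently with probabilities `q`. -/
def vertexMarginal {U : Type*} [DecidableEq U] (q : U → ℝ) : List U → U → ℝ
  | [] => 0
  | u :: l => q u • Pi.single u 1 + (1 - q u) • vertexMarginal q l

/-- The marginals of the randomized strategies that probe at most `k` elements of `S`. -/
def marginalPolytope {U : Type*} [DecidableEq U] (q : U → ℝ) (S : Set U) (k : ℕ) : Set (U → ℝ) :=
  convexHull ℝ {z | ∃ l : List U, l.Nodup ∧ (∀ u ∈ l, u ∈ S) ∧ l.length ≤ k ∧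
    vertexMarginal q l = z}

section Marginal

variable {U : Type*} [DecidableEq U] {q : U → ℝ} {S : Set U} {k : ℕ}

theorem vertexMarginal_apply_of_notMem {l : List U} {u : U} (h : u ∉ l) :
    vertexMarginal q l u = 0 := by
  induction l with
  | nil => rfl
  | cons a l ih =>
    rw [List.mem_cons, not_or] at h
    simp [vertexMarginal, ih h.2, Pi.single_eq_of_ne h.1]

theorem vertexMarginal_update {l : List U} {u : U} (h : u ∉ l) (c : ℝ) :
    vertexMarginal (Function.update q u c) l = vertexMarginal q l := by
  induction l with
  | nil => rfl
  | cons a l ih =>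
    rw [List.mem_cons, not_or] at h
    simp only [vertexMarginal, ih h.2, Function.update_of_ne (Ne.symm h.1)]

theorem vertexMarginal_nonneg (hq0 : ∀ u, 0 ≤ q u) (hq1 : ∀ u, q u ≤ 1) (l : List U) (u : U) :
    0 ≤ vertexMarginal q l u := by
  induction l with
  | nil => exact le_rfl
  | cons a l ih =>
    simp only [vertexMarginal, Pi.add_apply, Pi.smul_apply, smul_eq_mul]
    refine add_nonneg (mul_nonneg (hq0 a) ?_) (mul_nonneg (sub_nonneg.2 (hq1 a)) ih)
    rw [Pi.single_apply]
    split_ifs <;> norm_num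

theorem vertexMarginal_le (hq0 : ∀ u, 0 ≤ q u) (hq1 : ∀ u, q u ≤ 1) {l : List U}
    (hl : l.Nodup) (u : U) : vertexMarginal q l u ≤ q u := by
  induction l with
  | nil => exact hq0 u
  | cons a l ih =>
    rw [List.nodup_cons] at hl
    simp only [vertexMarginal, Pi.add_apply, Pi.smul_apply, smul_eq_mul]
    by_cases h : u = a
    · subst h
      simp [vertexMarginal_apply_of_notMem hl.1]
    · rw [Pi.single_eq_of_ne h]
      nlinarith [ih hl.2, vertexMarginal_nonneg hq0 hq1 l u, hq0 a]

theorem convex_marginalPolytope : Convex ℝ (marginalPolytope q S k) := convex_convexHull ℝ _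

theorem vertexMarginal_mem {l : List U} (hl : l.Nodup) (hS : ∀ u ∈ l, u ∈ S)
    (hk : l.length ≤ k) : vertexMarginal q l ∈ marginalPolytope q S k :=
  subset_convexHull ℝ _ ⟨l, hl, hS, hk, rfl⟩

theorem zero_mem_marginalPolytope : 0 ∈ marginalPolytope q S k :=
  vertexMarginal_mem (l := []) List.nodup_nil (by simp) (Nat.zero_le k)

theorem marginalPolytope_mono {S' : Set U} {k' : ℕ} (hS : S ⊆ S') (hk : k ≤ k') :
    marginalPolytope q S k ⊆ marginalPolytope q S' k' :=
  convexHull_mono fun _ ⟨l, hl, h, hlen, hz⟩ =>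
    ⟨l, hl, fun u hu => hS (h u hu), hlen.trans hk, hz⟩

/-- First probe `u`, and continue only if it is inactive. -/
theorem probe_mem_marginalPolytope {S' : Set U} {u : U} (hu : u ∈ S) (hS : S' ⊆ S) (hu' : u ∉ S')
    {z : U → ℝ} (hz : z ∈ marginalPolytope q S' k) :
    q u • Pi.single u 1 + (1 - q u) • z ∈ marginalPolytope q S (k + 1) := by
  have hconv : Convex ℝ {z : U → ℝ | q u • Pi.single u (1 : ℝ) + (1 - q u) • z ∈
      marginalPolytope q S (k + 1)} := by
    intro x hx y hy a b ha hb hab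
    have := convex_marginalPolytope hx hy ha hb hab
    have e : q u • Pi.single u (1 : ℝ) + (1 - q u) • (a • x + b • y) =
        a • (q u • Pi.single u (1 : ℝ) + (1 - q u) • x) +
          b • (q u • Pi.single u (1 : ℝ) + (1 - q u) • y) := by
      obtain rfl : b = 1 - a := by linarith
      module
    simpa only [Set.mem_ofPred_eq, e] using this
  refine convexHull_min ?_ hconv hz
  rintro _ ⟨l, hl, h, hlen, rfl⟩
  refine vertexMarginal_mem (l := u :: l) (List.nodup_cons.2 ⟨fun hul => hu' (h u hul), hl⟩) ?_
    (by simpa using hlen)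
  rintro a ha
  rcases List.mem_cons.1 ha with rfl | ha
  exacts [hu, hS (h a ha)]

theorem mem_marginalPolytope_nonneg (hq0 : ∀ u, 0 ≤ q u) (hq1 : ∀ u, q u ≤ 1) {z : U → ℝ}
    (hz : z ∈ marginalPolytope q S k) (u : U) : 0 ≤ z u := by
  have hconv : Convex ℝ {z : U → ℝ | 0 ≤ z u} :=
    convex_halfSpace_ge (LinearMap.proj (R := ℝ) (φ := fun _ : U => ℝ) u).isLinear 0
  refine convexHull_min ?_ hconv hz
  rintro _ ⟨l, -, -, -, rfl⟩
  exact vertexMarginal_nonneg hq0 hq1 l u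

theorem mem_marginalPolytope_le (hq0 : ∀ u, 0 ≤ q u) (hq1 : ∀ u, q u ≤ 1) {z : U → ℝ}
    (hz : z ∈ marginalPolytope q S k) (u : U) : z u ≤ q u := by
  have hconv : Convex ℝ {z : U → ℝ | z u ≤ q u} :=
    convex_halfSpace_le (LinearMap.proj (R := ℝ) (φ := fun _ : U => ℝ) u).isLinear (q u)
  refine convexHull_min ?_ hconv hz
  rintro _ ⟨l, hl, -, -, rfl⟩
  exact vertexMarginal_le hq0 hq1 hl u

/-- A probe of an entry `a` outside `T` is simulated by a coin that stops with probability `q a`: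
later entries are reached with unchanged probability, and `a` is never returned. -/
theorem indicator_vertexMarginal_mem (hq0 : ∀ u, 0 ≤ q u) (hq1 : ∀ u, q u ≤ 1) (T : Set U)
    {l : List U} (hl : l.Nodup) :
    T.indicator (vertexMarginal q l) ∈ marginalPolytope q {u | u ∈ l} l.length := by
  induction l with
  | nil =>
    rw [vertexMarginal, Set.indicator_zero']
    exact zero_mem_marginalPolytope
  | cons a l ih =>
    rw [List.nodup_cons] at hl
    by_cases ha : a ∈ T
    · have e : T.indicator (vertexMarginal q (a :: l)) =
          q a • Pi.single a 1 + (1 - q a) • T.indicator (vertexMarginal q l) := by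
        ext u
        by_cases hu : u ∈ T
        · simp [vertexMarginal, hu]
        · have : u ≠ a := fun h => hu (h ▸ ha)
          simp [hu, Pi.single_eq_of_ne this]
      rw [e]
      exact probe_mem_marginalPolytope (S := {u | u ∈ a :: l}) (S' := {u | u ∈ l})
        List.mem_cons_self (fun u hu => List.mem_cons_of_mem a hu) hl.1 (ih hl.2)
    · have e : T.indicator (vertexMarginal q (a :: l)) =
          q a • 0 + (1 - q a) • T.indicator (vertexMarginal q l) := by
        ext u
        by_cases hu : u ∈ T
        · have : u ≠ a := fun h => ha (h ▸ hu)
          simp [vertexMarginal, hu, Pi.single_eq_of_ne this]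
        · simp [hu]
      rw [e]
      exact convex_marginalPolytope zero_mem_marginalPolytope
        (marginalPolytope_mono (fun u hu => List.mem_cons_of_mem a hu) (by simp) (ih hl.2))
        (hq0 a) (sub_nonneg.2 (hq1 a)) (by ring)

/-- The marginals outside `T` can be set to zero without changing those inside. -/
theorem indicator_mem_marginalPolytope (hq0 : ∀ u, 0 ≤ q u) (hq1 : ∀ u, q u ≤ 1) (T : Set U)
    {z : U → ℝ} (hz : z ∈ marginalPolytope q S k) :
    T.indicator z ∈ marginalPolytope q S k := by
  have hconv : Convex ℝ {z : U → ℝ | T.indicator z ∈ marginalPolytope q S k} := by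
    intro x hx y hy a b ha hb hab
    have := convex_marginalPolytope hx hy ha hb hab
    have e : T.indicator (a • x + b • y) = a • T.indicator x + b • T.indicator y := by
      ext u
      by_cases hu : u ∈ T <;> simp [hu]
    simpa only [Set.mem_ofPred_eq, e] using this
  refine convexHull_min ?_ hconv hz
  rintro _ ⟨l, hl, h, hlen, rfl⟩
  exact marginalPolytope_mono (fun u hu => h u hu) hlen (indicator_vertexMarginal_mem hq0 hq1 T hl)

/-- The probability that the first active entry of a list is `u`. -/
theorem bernoulliExp_find? [Fintype U] (q : U → ℝ) {l : List U} (hl : l.Nodup) (u : U) :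
    bernoulliExp q (fun s => if l.find? s = some u then 1 else 0) = vertexMarginal q l u := by
  induction l generalizing q with
  | nil => simp [bernoulliExp_const, vertexMarginal]
  | cons a l ih =>
    rw [List.nodup_cons] at hl
    rw [bernoulliExp_reveal q a (f₁ := fun _ => if a = u then 1 else 0)
      (f₀ := fun s => if l.find? s = some u then 1 else 0) (fun s hs => by simp [hs])
      (fun s hs => by simp [hs]), bernoulliExp_const, ih _ hl.2, vertexMarginal_update hl.1]
    simp [vertexMarginal, Pi.single_apply, eq_comm]

end Marginal

/-! ### The linear program bounds the committal benchmark -/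

/-! ### Partial matchings and committal edge insertion -/

section AddEdge

variable {U V : Type*} [DecidableEq U] [Fintype V] [DecidableEq V]

theorem addEdge_apply_of_some {M : V → Option U} {s : V} {a : U} (h : M s = some a) (u : U)
    (v : V) : addEdge M u v s = some a := by
  unfold addEdge
  split_ifs with hM
  · have : s ≠ v := by
      rintro rfl
      simp [hM.1] at h
    rw [Function.update_of_ne this, h]
  · exact h

theorem addEdge_apply_of_ne (M : V → Option U) (u : U) {v s : V} (h : s ≠ v) :
    addEdge M u v s = M s := by
  unfold addEdge
  split_ifs
  · exact Function.update_of_ne h _ _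
  · rfl

theorem addEdge_eq_self_of_matched {M : V → Option U} {u : U} (h : ∃ s, M s = some u) (v : V) :
    addEdge M u v = M :=
  if_neg fun hM => h.elim fun s hs => hM.2 s hs

theorem addEdge_apply_self {M : V → Option U} {u : U} {v : V} (hv : M v = none)
    (hu : ∀ s, M s ≠ some u) : addEdge M u v v = some u := by
  rw [addEdge, if_pos ⟨hv, hu⟩, Function.update_self]

/-- No offline vertex is matched twice. -/
def IsMatching (M : V → Option U) : Prop :=
  ∀ s t u, M s = some u → M t = some u → s = t

theorem IsMatching.addEdge {M : V → Option U} (hM : IsMatching M) (u : U) (v : V) :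
    IsMatching (addEdge M u v) := by
  unfold _root_.addEdge
  split_ifs with h
  · intro s t a hs ht
    by_cases hsv : s = v <;> by_cases htv : t = v
    · rw [hsv, htv]
    · subst hsv
      rw [Function.update_self] at hs
      rw [Function.update_of_ne htv, ← hs] at ht
      exact absurd ht (h.2 t)
    · subst htv
      rw [Function.update_self] at ht
      rw [Function.update_of_ne hsv, ← ht] at hs
      exact absurd hs (h.2 s)
    · rw [Function.update_of_ne hsv] at hs
      rw [Function.update_of_ne htv] at ht
      exact hM s t a hs ht
  · exact hM

theorem isMatching_empty : IsMatching (fun _ : V => (none : Option U)) := by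
  intro s t u h
  simp at h

end AddEdge

/-! ### Matching probabilities of adaptive algorithms -/

namespace ProbingAlgorithm

variable {U V : Type*} [Fintype U] [DecidableEq U] [Fintype V] [DecidableEq V]

/-- The probability over the coin flips that the algorithm, started from the matching `M` with
edge states `st`, matches `v` to `u`. -/
def matchProb (st : U → V → Bool) (v : V) (u : U) : ProbingAlgorithm U V → (V → Option U) → ℝ
  | .halt, M => if M v = some u then 1 else 0
  | .probe a s A B, M =>
      if st a s then matchProb st v u A (addEdge M a s) else matchProb st v u B M
  | .coin q A B, M => q.1 * matchProb st v u A M + (1 - q.1) * matchProb st v u B M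

/-- Edges are never removed, so once `v` is matched the rest of the decision tree is irrelevant to
it. -/
theorem matchProb_of_some (st : U → V → Bool) {v : V} {a : U} (u : U)
    (A : ProbingAlgorithm U V) : ∀ {M : V → Option U}, M v = some a →
      matchProb st v u A M = (Pi.single a 1 : U → ℝ) u := by
  induction A with
  | halt =>
    intro M hM
    simp [matchProb, hM, Pi.single_apply, eq_comm]
  | probe b s A B ihA ihB =>
    intro M hM
    rw [matchProb]
    split_ifs
    exacts [ihA (addEdge_apply_of_some hM b s), ihB hM]
  | coin q A B ihA ihB =>
    intro M hM
    rw [matchProb, ihA hM, ihB hM]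
    ring

/-- At each leaf the bound says that `u` has at most one partner, and coins only average. This is
the source of the offline constraint. -/
theorem sum_matchProb_le_one (st : U → V → Bool) (u : U) (A : ProbingAlgorithm U V) :
    ∀ {M : V → Option U}, IsMatching M → ∑ v, matchProb st v u A M ≤ 1 := by
  induction A with
  | halt =>
    intro M hM
    simp only [matchProb, Finset.sum_boole, Nat.cast_le_one, Finset.card_le_one,
      Finset.mem_filter_univ]
    exact fun s hs t ht => hM s t u hs ht
  | probe b s A B ihA ihB =>
    intro M hM
    simp only [matchProb]
    split_ifs
    exacts [ihA (hM.addEdge b s), ihB hM]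
  | coin q A B ihA ihB =>
    intro M hM
    simp only [matchProb, Finset.sum_add_distrib, ← Finset.mul_sum]
    nlinarith [ihA hM, ihB hM, q.2.1, q.2.2]

theorem _root_.StochasticGraph.matchingValue_eq_sum (G : StochasticGraph U V)
    (M : V → Option U) :
    G.matchingValue M = ∑ v, ∑ u, G.w u v * (if M v = some u then 1 else 0) := by
  refine Finset.sum_congr rfl fun v _ => ?_
  cases M v <;> simp

theorem _root_.StochasticGraph.runValue_eq_sum (G : StochasticGraph U V) (st : U → V → Bool)
    (A : ProbingAlgorithm U V) : ∀ M : V → Option U,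
      G.runValue st A M = ∑ v, ∑ u, G.w u v * matchProb st v u A M := by
  induction A with
  | halt => exact G.matchingValue_eq_sum
  | probe b s A B ihA ihB =>
    intro M
    simp only [matchProb, StochasticGraph.runValue]
    split_ifs
    exacts [ihA _, ihB _]
  | coin q A B ihA ihB =>
    intro M
    simp only [matchProb, StochasticGraph.runValue, ihA, ihB, Finset.mul_sum,
      ← Finset.sum_add_distrib]
    refine Finset.sum_congr rfl fun v _ => Finset.sum_congr rfl fun u _ => ?_
    ring

/-- The marginals at `v` of an adaptive algorithm are those of a randomized choice of a tuple.
Here `S` is the set of the `u` for which the state of `(u, v)` has not been revealed. -/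
theorem matchProb_mem_marginalPolytope (q : U → ℝ) (v : V) (A : ProbingAlgorithm U V) :
    ∀ {M : V → Option U} {S : Set U} {p : U × V → ℝ}, (∀ e, 0 ≤ p e) → (∀ e, p e ≤ 1) →
      (∀ u ∈ S, p (u, v) = q u) → (∀ u ∉ S, p (u, v) = 0 ∨ ∃ s, M s = some u) → M v = none →
      (fun u => bernoulliExp p (fun s => matchProb (fun a b => s (a, b)) v u A M)) ∈
        marginalPolytope q S (A.maxProbes v) := by
  induction A with
  | halt =>
    intro M S p _ _ _ _ hM
    simp only [matchProb, hM, reduceCtorEq, if_false, bernoulliExp_const]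
    exact zero_mem_marginalPolytope
  | coin c A B ihA ihB =>
    intro M S p hp0 hp1 hS hS' hM
    simp only [matchProb, bernoulliExp_add, bernoulliExp_const_mul]
    exact convex_marginalPolytope
      (marginalPolytope_mono subset_rfl (le_max_left _ _) (ihA hp0 hp1 hS hS' hM))
      (marginalPolytope_mono subset_rfl (le_max_right _ _) (ihB hp0 hp1 hS hS' hM))
      c.2.1 (sub_nonneg.2 c.2.2) (by ring)
  | probe a t A B ihA ihB =>
    intro M S p hp0 hp1 hS hS' hM
    set e : U × V := (a, t) with he
    have hup0 : ∀ c : ℝ, 0 ≤ c → ∀ i, 0 ≤ Function.update p e c i := by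
      intro c hc i
      rw [Function.update_apply]
      split_ifs
      exacts [hc, hp0 i]
    have hup1 : ∀ c : ℝ, c ≤ 1 → ∀ i, Function.update p e c i ≤ 1 := by
      intro c hc i
      rw [Function.update_apply]
      split_ifs
      exacts [hc, hp1 i]
    have hsplit : (fun u => bernoulliExp p
          (fun s => matchProb (fun a b => s (a, b)) v u (.probe a t A B) M)) =
        p e • (fun u => bernoulliExp (Function.update p e 1)
          (fun s => matchProb (fun a b => s (a, b)) v u A (addEdge M a t))) +
        (1 - p e) • (fun u => bernoulliExp (Function.update p e 0)
          (fun s => matchProb (fun a b => s (a, b)) v u B M)) := by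
      ext u
      exact bernoulliExp_reveal p e (fun s hs => if_pos hs)
        (fun s hs => if_neg (by simp only [← he, hs]; decide))
    rw [hsplit]
    have hkA : A.maxProbes v ≤ (ProbingAlgorithm.probe a t A B).maxProbes v :=
      (le_max_left _ _).trans (Nat.le_add_left _ _)
    have hkB : B.maxProbes v ≤ (ProbingAlgorithm.probe a t A B).maxProbes v :=
      (le_max_right _ _).trans (Nat.le_add_left _ _)
    have hpe : 0 ≤ 1 - p e := sub_nonneg.2 (hp1 e)
    by_cases htv : t = v
    · subst htv
      have hne : ∀ u, u ≠ a → ∀ c, Function.update p e c (u, t) = p (u, t) := fun u hu c =>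
        Function.update_of_ne (by simpa [he] using hu) _ _
      -- If `a` is already matched, the probe cannot change the matching and acts as a coin; both
      -- branches continue with `a` removed from `S`.
      by_cases ha : ∃ s, M s = some a
      · have hIS : ∀ c, ∀ u ∈ S \ {a}, Function.update p e c (u, t) = q u := fun c u hu => by
          rw [hne u hu.2, hS u hu.1]
        have hIS' : ∀ c, ∀ u ∉ S \ {a}, Function.update p e c (u, t) = 0 ∨
            ∃ s, M s = some u := fun c u hu => by
          by_cases hua : u = a
          · exact .inr (hua ▸ ha)
          · rw [hne u hua]
            exact hS' u fun h => hu ⟨h, hua⟩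
        rw [addEdge_eq_self_of_matched ha]
        exact convex_marginalPolytope
          (marginalPolytope_mono Set.sdiff_subset hkA
            (ihA (hup0 1 zero_le_one) (hup1 1 le_rfl) (hIS 1) (hIS' 1) hM))
          (marginalPolytope_mono Set.sdiff_subset hkB
            (ihB (hup0 0 le_rfl) (hup1 0 zero_le_one) (hIS 0) (hIS' 0) hM))
          (hp0 e) hpe (by ring)
      · have hz := ihB (S := S \ {a}) (M := M) (hup0 0 le_rfl) (hup1 0 zero_le_one)
          (fun u hu => by rw [hne u hu.2, hS u hu.1])
          (fun u hu => by
            by_cases hua : u = a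
            · exact .inl (by rw [hua, ← he, Function.update_self])
            · rw [hne u hua]
              exact hS' u fun h => hu ⟨h, hua⟩) hM
        by_cases haS : a ∈ S
        -- Here `a` and `v` are both free, so commitment fixes the match when the edge is active.
        -- The marginals are those of probing `a` first and continuing only on failure, at the cost
        -- of one unit of patience.
        · have hone : (fun u => bernoulliExp (Function.update p e 1)
              (fun s => matchProb (fun a b => s (a, b)) t u A (addEdge M a t))) =
                Pi.single a 1 := by
            ext u
            simp only [matchProb_of_some _ u A (addEdge_apply_self hM (not_exists.1 ha)),
              bernoulliExp_const]
          rw [hone, he, hS a haS, ← he]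
          refine marginalPolytope_mono subset_rfl ?_
            (probe_mem_marginalPolytope haS Set.sdiff_subset (by simp) hz)
          simp only [maxProbes, if_pos]
          omega
        -- The edge is already known to be inactive, so only the inactive branch has positive
        -- weight.
        · rw [(hS' a haS).resolve_right ha, zero_smul, sub_zero, one_smul, zero_add]
          exact marginalPolytope_mono Set.sdiff_subset hkB hz
    -- A probe at another online vertex reveals nothing about the edges at `v`: it is a coin that
    -- may at most use up an offline vertex.
    · have hne : ∀ u, ∀ c, Function.update p e c (u, v) = p (u, v) := fun u c =>
        Function.update_of_ne (by simpa [he] using fun _ => Ne.symm htv) _ _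
      refine convex_marginalPolytope
        (marginalPolytope_mono subset_rfl hkA (ihA (hup0 1 zero_le_one) (hup1 1 le_rfl)
          (fun u hu => by rw [hne, hS u hu]) (fun u hu => ?_) ?_))
        (marginalPolytope_mono subset_rfl hkB (ihB (hup0 0 le_rfl) (hup1 0 zero_le_one)
          (fun u hu => by rw [hne, hS u hu]) (fun u hu => by rw [hne]; exact hS' u hu) hM))
        (hp0 e) hpe (by ring)
      · rw [hne]
        exact (hS' u hu).imp id fun ⟨s, hs⟩ => ⟨s, addEdge_apply_of_some hs a t⟩
      · rw [addEdge_apply_of_ne M a (Ne.symm htv), hM]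

end ProbingAlgorithm

namespace StochasticGraph

variable {U V : Type*} [Fintype U] [DecidableEq U] [Fintype V] [DecidableEq V]

theorem expectedValue_eq_bernoulliExp (G : StochasticGraph U V) (A : ProbingAlgorithm U V) :
    G.expectedValue A = bernoulliExp (fun e : U × V => G.p e.1 e.2)
      (fun s => G.runValue (fun a b => s (a, b)) A (fun _ => none)) := by
  unfold expectedValue bernoulliExp
  refine (Fintype.sum_equiv (Equiv.curry U V Bool) _ _ fun s => ?_).symm
  rw [Fintype.prod_prod_type]
  rfl

/-- The marginals of an algorithm respecting patience satisfy the constraints of the linear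
program. -/
theorem exists_marginals (G : StochasticGraph U V) {A : ProbingAlgorithm U V}
    (hA : G.RespectsPatience A) :
    ∃ z : V → U → ℝ,
      (∀ v, z v ∈ marginalPolytope (fun u => G.p u v) Set.univ (G.patience v)) ∧
      (∀ u, ∑ v, z v u ≤ 1) ∧ G.expectedValue A = ∑ v, ∑ u, G.w u v * z v u := by
  refine ⟨fun v u => bernoulliExp (fun e : U × V => G.p e.1 e.2)
    (fun s => A.matchProb (fun a b => s (a, b)) v u (fun _ => none)), fun v => ?_, fun u => ?_, ?_⟩
  · exact marginalPolytope_mono subset_rfl (hA v)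
      (A.matchProb_mem_marginalPolytope _ v (fun e => G.p_nonneg _ _) (fun e => G.p_le_one _ _)
        (fun u _ => rfl) (fun u hu => absurd (Set.mem_univ u) hu) rfl)
  · rw [← bernoulliExp_sum]
    refine (bernoulliExp_mono (fun e => G.p_nonneg _ _) (fun e => G.p_le_one _ _)
      fun s => A.sum_matchProb_le_one _ u isMatching_empty).trans_eq (bernoulliExp_const _ _)
  · rw [expectedValue_eq_bernoulliExp]
    simp only [runValue_eq_sum, bernoulliExp_sum, bernoulliExp_const_mul]

end StochasticGraph

namespace StochasticGraph

variable {U V : Type*} [Fintype U] [DecidableEq U] [Fintype V] [DecidableEq V]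

/-! ### The linear program in terms of marginals -/

/-- This passes from the indexed product to the recursion: by conditioning on the head being
inactive, every later `g` acquires the factor `1 - p`. -/
theorem sum_mul_g (G : StochasticGraph U V) (v : V) (f : U → ℝ) (l : List U) :
    ∑ i : Fin l.length, f (l.get i) * G.g v l i =
      ∑ u, f u * vertexMarginal (fun u => G.p u v) l u := by
  induction l with
  | nil => simp [vertexMarginal]
  | cons a l ih =>
    have h0 : G.g v (a :: l) 0 = G.p a v := by simp [g]
    have hs : ∀ i : Fin l.length, G.g v (a :: l) i.succ = (1 - G.p a v) * G.g v l i := by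
      intro i
      simp only [g, Finset.prod_filter]
      rw [mul_left_comm]
      congr 1
      refine (Fin.prod_univ_succ (n := l.length) _).trans ?_
      simp
    refine (Fin.sum_univ_succ (n := l.length) _).trans ?_
    have : ∑ i : Fin l.length, f ((a :: l).get i.succ) * G.g v (a :: l) i.succ =
        (1 - G.p a v) * ∑ u, f u * vertexMarginal (fun u => G.p u v) l u := by
      rw [← ih, Finset.mul_sum]
      refine Finset.sum_congr rfl fun i _ => ?_
      rw [hs]
      exact mul_left_comm _ _ _
    rw [this]
    simp only [vertexMarginal, Pi.add_apply, Pi.smul_apply, smul_eq_mul, mul_add,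
      Finset.sum_add_distrib, Finset.mul_sum, Pi.single_apply]
    congr 1
    · rw [Finset.sum_eq_single a (fun b _ hb => by simp [hb]) (by simp)]
      simp only [if_true, mul_one]
      exact congrArg _ h0
    · exact Finset.sum_congr rfl fun u _ => by ring

/-- The entry at `u` is the probability that `VertexProbe` at `v` returns `u`. -/
noncomputable def marginal (G : StochasticGraph U V) (x : G.LPVar) (v : V) : U → ℝ :=
  ∑ t, x v t • vertexMarginal (fun u => G.p u v) t.1

theorem marginal_apply (G : StochasticGraph U V) (x : G.LPVar) (v : V) (u : U) :
    G.marginal x v u = ∑ t, x v t * vertexMarginal (fun u => G.p u v) t.1 u := by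
  simp [marginal, Finset.sum_apply]

theorem lpObjective_eq_sum_marginal (G : StochasticGraph U V) (x : G.LPVar) :
    G.lpObjective x = ∑ v, ∑ u, G.w u v * G.marginal x v u := by
  refine Finset.sum_congr rfl fun v _ => ?_
  simp only [G.sum_mul_g v (fun u => G.w u v), marginal_apply, Finset.mul_sum, Finset.sum_mul]
  rw [Finset.sum_comm]
  exact Finset.sum_congr rfl fun u _ => Finset.sum_congr rfl fun t _ => by ring

theorem sum_offline_eq_sum_marginal (G : StochasticGraph U V) (x : G.LPVar) (u : U) :
    ∑ v, ∑ t : Tuple U (G.patience v),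
      ∑ i ∈ Finset.univ.filter (fun i : Fin t.1.length => t.1.get i = u), G.g v t.1 i * x v t =
      ∑ v, G.marginal x v u := by
  refine Finset.sum_congr rfl fun v _ => ?_
  rw [marginal_apply]
  refine Finset.sum_congr rfl fun t _ => ?_
  have h := G.sum_mul_g v (fun a => if a = u then 1 else 0) t.1
  simp only [ite_mul, one_mul, zero_mul, Finset.sum_ite_eq', Finset.mem_univ, if_true] at h
  rw [← h, Finset.sum_filter, Finset.mul_sum]
  refine Finset.sum_congr rfl fun i _ => ?_
  split_ifs <;> ring

theorem LPFeasible.sum_marginal_le_one {G : StochasticGraph U V} {x : G.LPVar}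
    (hx : G.LPFeasible x) (u : U) : ∑ v, G.marginal x v u ≤ 1 :=
  (G.sum_offline_eq_sum_marginal x u).symm.trans_le (hx.offline u)

/-- The draw probabilities, including passing, are convex weights; passing plays the role of the
empty list, whose marginal is zero. -/
theorem LPFeasible.marginal_mem {G : StochasticGraph U V} {x : G.LPVar}
    (hx : G.LPFeasible x) (v : V) :
    G.marginal x v ∈ marginalPolytope (fun u => G.p u v) Set.univ (G.patience v) := by
  have h := (convex_marginalPolytope (q := fun u => G.p u v) (S := Set.univ)
    (k := G.patience v)).sum_mem (t := (Finset.univ : Finset (Option (Tuple U (G.patience v)))))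
    (w := G.drawProb x v)
    (z := fun o => o.elim 0 fun t => vertexMarginal (fun u => G.p u v) t.1)
    (fun o _ => ?_) ?_ (fun o _ => ?_)
  · simpa [Fintype.sum_option, drawProb, marginal] using h
  · cases o with
    | none => exact sub_nonneg.2 (hx.online v)
    | some t => exact hx.nonneg v t
  · simp [Fintype.sum_option, drawProb]
  · cases o with
    | none => exact zero_mem_marginalPolytope
    | some t => exact vertexMarginal_mem t.2.1 (fun _ _ => Set.mem_univ _) t.2.2.2

theorem exists_weights_of_mem_marginalPolytope {q z : U → ℝ} {k : ℕ}
    (hz : z ∈ marginalPolytope q Set.univ k) :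
    ∃ y : Tuple U k → ℝ, (∀ t, 0 ≤ y t) ∧ ∑ t, y t ≤ 1 ∧
      ∑ t, y t • vertexMarginal q t.1 = z := by
  have hconv : Convex ℝ {z : U → ℝ | ∃ y : Tuple U k → ℝ, (∀ t, 0 ≤ y t) ∧ ∑ t, y t ≤ 1 ∧
      ∑ t, y t • vertexMarginal q t.1 = z} := by
    rintro _ ⟨y, hy0, hy1, rfl⟩ _ ⟨y', hy0', hy1', rfl⟩ a b ha hb hab
    refine ⟨fun t => a * y t + b * y' t,
      fun t => add_nonneg (mul_nonneg ha (hy0 t)) (mul_nonneg hb (hy0' t)), ?_, ?_⟩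
    · rw [Finset.sum_add_distrib, ← Finset.mul_sum, ← Finset.mul_sum]
      nlinarith
    · simp only [add_smul, Finset.sum_add_distrib, mul_smul, Finset.smul_sum]
  refine convexHull_min ?_ hconv hz
  rintro _ ⟨l, hl, -, hlen, rfl⟩
  -- The empty list is not a `Tuple`; always passing realizes its marginal.
  by_cases h : l = []
  · subst h
    exact ⟨0, fun _ => le_rfl, by simp, by simp [vertexMarginal]⟩
  · refine ⟨Pi.single ⟨l, hl, h, hlen⟩ 1, fun t => ?_, by simp, ?_⟩
    · rw [Pi.single_apply]
      split_ifs <;> norm_num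
    · rw [Finset.sum_eq_single ⟨l, hl, h, hlen⟩ (fun t _ ht => by simp [ht]) (by simp)]
      simp

theorem exists_lpFeasible_of_marginals (G : StochasticGraph U V) {z : V → U → ℝ}
    (hz : ∀ v, z v ∈ marginalPolytope (fun u => G.p u v) Set.univ (G.patience v))
    (hoff : ∀ u, ∑ v, z v u ≤ 1) :
    ∃ x : G.LPVar, G.LPFeasible x ∧ G.marginal x = z := by
  choose y hy0 hy1 hyz using fun v => exists_weights_of_mem_marginalPolytope (hz v)
  have hm : G.marginal y = z := funext hyz
  refine ⟨y, ⟨fun u => ?_, hy1, hy0⟩, hm⟩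
  rw [sum_offline_eq_sum_marginal, hm]
  exact hoff u

/-- Optimality restated without tuples, so that a competitor need only be given by its marginals. -/
theorem LPOptimal.sum_le {G : StochasticGraph U V} {x : G.LPVar} (hx : G.LPOptimal x)
    {z : V → U → ℝ}
    (hz : ∀ v, z v ∈ marginalPolytope (fun u => G.p u v) Set.univ (G.patience v))
    (hoff : ∀ u, ∑ v, z v u ≤ 1) :
    ∑ v, ∑ u, G.w u v * z v u ≤ ∑ v, ∑ u, G.w u v * G.marginal x v u := by
  obtain ⟨y, hy, rfl⟩ := G.exists_lpFeasible_of_marginals hz hoff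
  rw [← lpObjective_eq_sum_marginal, ← lpObjective_eq_sum_marginal]
  exact hx.2 y hy

/-- The value of the linear program is an upper bound on the committal benchmark. -/
theorem LPOptimal.OPT_le {G : StochasticGraph U V} {x : G.LPVar} (hx : G.LPOptimal x) :
    G.OPT ≤ ∑ v, ∑ u, G.w u v * G.marginal x v u := by
  have : Nonempty {A : ProbingAlgorithm U V // G.RespectsPatience A} :=
    ⟨⟨.halt, fun v => Nat.zero_le _⟩⟩
  refine ciSup_le fun A => ?_
  obtain ⟨z, hz, hoff, hval⟩ := G.exists_marginals A.2
  rw [hval]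
  exact hx.sum_le hz hoff

theorem LPFeasible.marginal_nonneg {G : StochasticGraph U V} {x : G.LPVar}
    (hx : G.LPFeasible x) (v : V) (u : U) : 0 ≤ G.marginal x v u :=
  mem_marginalPolytope_nonneg (fun u => G.p_nonneg u v) (fun u => G.p_le_one u v)
    (hx.marginal_mem v) u

theorem LPFeasible.marginal_le {G : StochasticGraph U V} {x : G.LPVar}
    (hx : G.LPFeasible x) (v : V) (u : U) : G.marginal x v u ≤ G.p u v :=
  mem_marginalPolytope_le (fun u => G.p_nonneg u v) (fun u => G.p_le_one u v)
    (hx.marginal_mem v) u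

/-- An optimal solution does not use edges of negative weight. -/
theorem LPOptimal.marginal_eq_zero {G : StochasticGraph U V} {x : G.LPVar} (hx : G.LPOptimal x)
    {u : U} {v : V} (hw : G.w u v < 0) : G.marginal x v u = 0 := by
  set z : V → U → ℝ := fun v => {u | 0 ≤ G.w u v}.indicator (G.marginal x v) with hz
  have hle : ∀ v u, z v u ≤ G.marginal x v u := fun v u =>
    Set.indicator_apply_le' (fun _ => le_rfl) fun _ => hx.1.marginal_nonneg v u
  have hmono : ∀ v u, G.w u v * G.marginal x v u ≤ G.w u v * z v u := by
    intro v u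
    by_cases h : 0 ≤ G.w u v
    · simp [hz, h]
    · simpa [hz, h] using
        mul_nonpos_of_nonpos_of_nonneg (not_le.1 h).le (hx.1.marginal_nonneg v u)
  have hopt := hx.sum_le (z := z)
    (fun v => indicator_mem_marginalPolytope (fun u => G.p_nonneg u v) (fun u => G.p_le_one u v) _
      (hx.1.marginal_mem v))
    (fun u => (Finset.sum_le_sum fun v _ => hle v u).trans (hx.1.sum_marginal_le_one u))
  -- Otherwise zeroing the marginals on all edges of negative weight would strictly improve the
  -- objective.
  by_contra hne
  refine hopt.not_gt (Finset.sum_lt_sum (fun v _ => Finset.sum_le_sum fun u _ => hmono v u)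
    ⟨v, Finset.mem_univ v, Finset.sum_lt_sum (fun u _ => hmono v u) ⟨u, Finset.mem_univ u, ?_⟩⟩)
  have : z v u = 0 := by simp [hz, hw]
  rw [this, mul_zero]
  exact mul_neg_of_neg_of_pos hw ((hx.1.marginal_nonneg v u).lt_of_ne' hne)

end StochasticGraph

/-! ### Random orders -/

theorem Fintype.sum_equiv_lt {ι V : Type*} [Fintype ι] [DecidableEq ι] [LinearOrder ι] [Fintype V]
    [DecidableEq V] {v v' : V} (h : v' ≠ v) :
    ∑ π : ι ≃ V, (if π.symm v' < π.symm v then (1 : ℝ) else 0) =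
      1 / 2 * (Fintype.card (ι ≃ V) : ℝ) := by
  have hswap : ∑ π : ι ≃ V, (if π.symm v' < π.symm v then (1 : ℝ) else 0) =
      ∑ π : ι ≃ V, (if π.symm v < π.symm v' then (1 : ℝ) else 0) := by
    -- Exchanging the positions of `v` and `v'` is a bijection of the orders that swaps the two
    -- events.
    refine Fintype.sum_equiv ((Equiv.refl ι).equivCongr (Equiv.swap v v')) _ _ fun π => ?_
    simp [Equiv.equivCongr]
  have hsum : ∑ π : ι ≃ V, (if π.symm v' < π.symm v then (1 : ℝ) else 0) +
      ∑ π : ι ≃ V, (if π.symm v < π.symm v' then (1 : ℝ) else 0) =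
        (Fintype.card (ι ≃ V) : ℝ) := by
    rw [← Finset.sum_add_distrib, ← nsmul_one, ← Finset.card_univ, ← Finset.sum_const]
    refine Finset.sum_congr rfl fun π _ => ?_
    rcases lt_or_gt_of_ne fun e => h (π.symm.injective e) with h' | h' <;>
      simp [h', h'.not_gt]
  linarith

/-! ### Greedy matching -/

section Greedy

variable {U V : Type*} [DecidableEq U] [Fintype V] [DecidableEq V]

/-- Processing the arrival of `v` when the vertex returned at `v` is `R v`. -/
def greedyStep (R : V → Option U) (M : V → Option U) (v : V) : V → Option U :=
  (R v).elim M (fun u => addEdge M u v)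

theorem greedyStep_apply_of_some {R M : V → Option U} {s : V} {a : U} (h : M s = some a) (v : V) :
    greedyStep R M v s = some a := by
  unfold greedyStep
  cases R v with
  | none => exact h
  | some u => exact addEdge_apply_of_some h u v

theorem foldl_greedyStep_apply_of_some {R : V → Option U} {s : V} {a : U} (l : List V) :
    ∀ {M : V → Option U}, M s = some a → l.foldl (greedyStep R) M s = some a := by
  induction l with
  | nil => exact id
  | cons v l ih => exact fun h => ih (greedyStep_apply_of_some h v)

theorem greedyStep_eq_some {R M : V → Option U} {v s : V} {u : U}
    (h : greedyStep R M v s = some u) : M s = some u ∨ s = v ∧ R s = some u := by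
  unfold greedyStep at h
  cases hR : R v with
  | none => exact .inl (by simpa [hR] using h)
  | some a =>
    rw [hR, Option.elim_some, addEdge] at h
    split_ifs at h
    · by_cases hs : s = v
      · subst hs
        rw [Function.update_self] at h
        exact .inr ⟨rfl, hR.trans h⟩
      · rw [Function.update_of_ne hs] at h
        exact .inl h
    · exact .inl h

theorem foldl_greedyStep_eq_some {R : V → Option U} {s : V} {u : U} (l : List V) :
    ∀ {M : V → Option U}, l.foldl (greedyStep R) M s = some u →
      M s = some u ∨ s ∈ l ∧ R s = some u := by
  induction l with
  | nil => exact .inl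
  | cons v l ih =>
    intro M h
    rcases ih h with h | ⟨h, hR⟩
    · rcases greedyStep_eq_some h with h | ⟨rfl, hR⟩
      exacts [.inl h, .inr ⟨List.mem_cons_self, hR⟩]
    · exact .inr ⟨List.mem_cons_of_mem v h, hR⟩

/-- An unmatched `v` fails to take `u` only if `u` is taken already; in either case `u` is matched
afterwards. -/
theorem exists_greedyStep_eq_some {R M : V → Option U} {v : V} {u : U} (hR : R v = some u)
    (hv : M v = none) : ∃ s, greedyStep R M v s = some u := by
  unfold greedyStep
  rw [hR, Option.elim_some]
  by_cases h : ∃ s, M s = some u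
  · rw [addEdge_eq_self_of_matched h]
    exact h
  · exact ⟨v, addEdge_apply_self hv (not_exists.1 h)⟩

theorem IsMatching.foldl_greedyStep {R : V → Option U} (l : List V) :
    ∀ {M : V → Option U}, IsMatching M → IsMatching (l.foldl (greedyStep R) M) := by
  induction l with
  | nil => exact id
  | cons v l ih =>
    intro M hM
    refine ih ?_
    unfold greedyStep
    cases R v with
    | none => exact hM
    | some u => exact hM.addEdge u v

/-- The matching built greedily when the vertices arrive in the order `π`. -/
def greedyMatching {n : ℕ} (R : V → Option U) (π : Fin n ≃ V) : V → Option U :=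
  (List.ofFn π).foldl (greedyStep R) (fun _ => none)

variable {n : ℕ} {R : V → Option U} {π : Fin n ≃ V} {v : V} {u : U}

theorem ofFn_split (π : Fin n ≃ V) (v : V) : ∃ l₁ l₂ : List V, List.ofFn π = l₁ ++ v :: l₂ ∧
    ∀ s, s ∈ l₁ ↔ π.symm s < π.symm v := by
  refine ⟨(List.ofFn π).take (π.symm v), (List.ofFn π).drop (π.symm v + 1), ?_, fun s => ?_⟩
  · have hlt : (π.symm v : ℕ) < (List.ofFn π).length := by simp
    have hv : v = (List.ofFn π)[(π.symm v : ℕ)] := by simp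
    conv_rhs => enter [2, 1]; rw [hv]
    rw [List.cons_getElem_drop_succ, List.take_append_drop]
  · rw [List.mem_take_iff_getElem]
    constructor
    · rintro ⟨i, hi, rfl⟩
      rw [List.getElem_ofFn, Equiv.symm_apply_apply]
      exact Fin.lt_def.2 (lt_of_lt_of_le hi (min_le_left _ _))
    · intro h
      refine ⟨π.symm s, lt_min h (by simp), by simp⟩

theorem eq_some_of_greedyMatching (h : greedyMatching R π v = some u) : R v = some u := by
  rcases foldl_greedyStep_eq_some _ h with h | h
  · simp at h
  · exact h.2

/-- When `v` arrives it is still free, and `u` is free because no earlier arrival returned it. -/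
theorem greedyMatching_eq_some (hR : R v = some u)
    (h : ∀ s, π.symm s < π.symm v → R s ≠ some u) : greedyMatching R π v = some u := by
  obtain ⟨l₁, l₂, hl, hmem⟩ := ofFn_split π v
  rw [greedyMatching, hl, List.foldl_append, List.foldl_cons]
  refine foldl_greedyStep_apply_of_some _ ?_
  rw [greedyStep, hR, Option.elim_some]
  refine addEdge_apply_self ?_ fun s hs => ?_
  · rw [Option.eq_none_iff_forall_ne_some]
    intro a ha
    rcases foldl_greedyStep_eq_some _ ha with ha | ⟨ha, -⟩
    · simp at ha
    · exact lt_irrefl _ ((hmem v).1 ha)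
  · rcases foldl_greedyStep_eq_some _ hs with hs | ⟨hs, hs'⟩
    · simp at hs
    · exact h s ((hmem s).1 hs) hs'

/-- After the arrival of `v'` the vertex `u` has a partner for good, and this partner arrived no
later than `v'`, so it is not `v`. -/
theorem greedyMatching_ne_some {v' : V} (hR : R v' = some u) (h : π.symm v' < π.symm v) :
    greedyMatching R π v ≠ some u := by
  intro hv
  obtain ⟨l₁, l₂, hl, hmem⟩ := ofFn_split π v'
  have hM : IsMatching (greedyMatching R π) := isMatching_empty.foldl_greedyStep _
  have hnone : l₁.foldl (greedyStep R) (fun _ => none) v' = none := by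
    rw [Option.eq_none_iff_forall_ne_some]
    intro a ha
    rcases foldl_greedyStep_eq_some _ ha with ha | ⟨ha, -⟩
    · simp at ha
    · exact lt_irrefl _ ((hmem v').1 ha)
  obtain ⟨s, hs⟩ := exists_greedyStep_eq_some hR hnone
  have hs' : greedyMatching R π s = some u := by
    rw [greedyMatching, hl, List.foldl_append, List.foldl_cons]
    exact foldl_greedyStep_apply_of_some _ hs
  obtain rfl := hM s v u hs' hv
  rcases greedyStep_eq_some hs with hs | ⟨rfl, -⟩
  · rcases foldl_greedyStep_eq_some _ hs with hs | ⟨hs, -⟩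
    · simp at hs
    · exact lt_asymm h ((hmem s).1 hs)
  · exact lt_irrefl _ h

/-- The pointwise form of the union bound. Only pairs of returned vertices occur, so pairwise
independence suffices to take expectations. -/
theorem greedyMatching_lower (R : V → Option U) (π : Fin n ≃ V) (v : V) (u : U) :
    (if R v = some u then (1 : ℝ) else 0) - ∑ v' ∈ Finset.univ.erase v,
        (if π.symm v' < π.symm v then 1 else 0) *
          (if R v = some u ∧ R v' = some u then 1 else 0) ≤
      if greedyMatching R π v = some u then 1 else 0 := by
  have hnn : ∀ v' ∈ Finset.univ.erase v, (0 : ℝ) ≤ (if π.symm v' < π.symm v then 1 else 0) *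
      (if R v = some u ∧ R v' = some u then 1 else 0) := fun v' _ => by positivity
  by_cases hR : R v = some u
  · by_cases h : ∀ s, π.symm s < π.symm v → R s ≠ some u
    · rw [if_pos (greedyMatching_eq_some hR h), if_pos hR]
      linarith [Finset.sum_nonneg hnn]
    · push Not at h
      obtain ⟨s, hs, hRs⟩ := h
      have h1 := Finset.single_le_sum hnn
        (Finset.mem_erase.2 ⟨fun e : s = v => by simp [e] at hs, Finset.mem_univ s⟩)
      rw [if_pos hs, if_pos ⟨hR, hRs⟩] at h1
      rw [if_pos hR]
      have : (0 : ℝ) ≤ if greedyMatching R π v = some u then 1 else 0 := by positivity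
      linarith
  · have : (0 : ℝ) ≤ if greedyMatching R π v = some u then 1 else 0 := by positivity
    rw [if_neg hR]
    linarith [Finset.sum_nonneg hnn]

/-- Keeping a single competitor `v'` is enough for the tight example, which has only one. -/
theorem greedyMatching_upper (R : V → Option U) (π : Fin n ≃ V) (v v' : V) (u : U) :
    (if greedyMatching R π v = some u then (1 : ℝ) else 0) ≤
      (if R v = some u then 1 else 0) - (if π.symm v' < π.symm v then 1 else 0) *
          (if R v = some u ∧ R v' = some u then 1 else 0) := by
  by_cases h : greedyMatching R π v = some u
  · have hR := eq_some_of_greedyMatching h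
    rw [if_pos h, if_pos hR]
    by_cases hlt : π.symm v' < π.symm v
    · rw [if_neg fun hR' : R v = some u ∧ R v' = some u => greedyMatching_ne_some hR'.2 hlt h]
      simp
    · simp [hlt]
  · rw [if_neg h]
    split_ifs <;> simp_all

end Greedy

namespace StochasticGraph

variable {U V : Type*} [Fintype U] [DecidableEq U] [Fintype V] [DecidableEq V]

/-! ### The online algorithm -/

/-- The expectation over the edge states and the draws made by the online algorithm. -/
noncomputable def onlineExp (G : StochasticGraph U V) (x : G.LPVar)
    (f : (U → V → Bool) → ((v : V) → Option (Tuple U (G.patience v))) → ℝ) : ℝ :=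
  ∑ st : U → V → Bool, ∑ d : (v : V) → Option (Tuple U (G.patience v)),
    G.stateProb st * (∏ v, G.drawProb x v (d v)) * f st d

theorem onlineExp_sub (G : StochasticGraph U V) (x : G.LPVar)
    (f f' : (U → V → Bool) → ((v : V) → Option (Tuple U (G.patience v))) → ℝ) :
    G.onlineExp x (fun st d => f st d - f' st d) = G.onlineExp x f - G.onlineExp x f' := by
  simp only [onlineExp, mul_sub, Finset.sum_sub_distrib]

theorem onlineExp_const_mul (G : StochasticGraph U V) (x : G.LPVar) (c : ℝ)
    (f : (U → V → Bool) → ((v : V) → Option (Tuple U (G.patience v))) → ℝ) :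
    G.onlineExp x (fun st d => c * f st d) = c * G.onlineExp x f := by
  simp only [onlineExp, Finset.mul_sum]
  exact Finset.sum_congr rfl fun _ _ => Finset.sum_congr rfl fun _ _ => mul_left_comm _ _ _

theorem onlineExp_sum {κ : Type*} (K : Finset κ) (G : StochasticGraph U V) (x : G.LPVar)
    (f : κ → (U → V → Bool) → ((v : V) → Option (Tuple U (G.patience v))) → ℝ) :
    G.onlineExp x (fun st d => ∑ k ∈ K, f k st d) = ∑ k ∈ K, G.onlineExp x (f k) := by
  simp only [onlineExp, Finset.mul_sum]
  rw [Finset.sum_comm (s := K)]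
  exact Finset.sum_congr rfl fun _ _ => Finset.sum_comm

theorem onlineExp_mono {G : StochasticGraph U V} {x : G.LPVar} (hx : G.LPFeasible x)
    {f f' : (U → V → Bool) → ((v : V) → Option (Tuple U (G.patience v))) → ℝ}
    (h : ∀ st d, f st d ≤ f' st d) : G.onlineExp x f ≤ G.onlineExp x f' := by
  refine Finset.sum_le_sum fun st _ => Finset.sum_le_sum fun d _ =>
    mul_le_mul_of_nonneg_left (h st d) (mul_nonneg ?_ ?_)
  · refine Finset.prod_nonneg fun u _ => Finset.prod_nonneg fun v _ => ?_
    split_ifs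
    exacts [G.p_nonneg u v, sub_nonneg.2 (G.p_le_one u v)]
  · refine Finset.prod_nonneg fun v _ => ?_
    cases d v with
    | none => exact sub_nonneg.2 (hx.online v)
    | some t => exact hx.nonneg v t

/-- The expectation of a function of the offline vertex returned at `v`. -/
noncomputable def returnExp (G : StochasticGraph U V) (x : G.LPVar) (v : V)
    (h : Option U → ℝ) : ℝ :=
  ∑ o, G.drawProb x v o * bernoulliExp (fun u => G.p u v)
    (fun s => h (o.bind fun t => t.1.find? s))

theorem returnExp_one (G : StochasticGraph U V) (x : G.LPVar) (v : V) :
    G.returnExp x v (fun _ => 1) = 1 := by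
  simp [returnExp, bernoulliExp_const, Fintype.sum_option, drawProb]

theorem returnExp_eq_marginal (G : StochasticGraph U V) (x : G.LPVar) (v : V) (u : U) :
    G.returnExp x v (fun o => if o = some u then 1 else 0) = G.marginal x v u := by
  rw [returnExp, Fintype.sum_option, marginal_apply]
  simp only [Option.bind_none, Option.bind_some, reduceCtorEq, if_false, bernoulliExp_const,
    mul_zero, zero_add, drawProb]
  exact Finset.sum_congr rfl fun t _ => by rw [bernoulliExp_find? _ t.2.1]

/-- The offline vertices returned at the different online vertices are independent. -/
theorem onlineExp_prod (G : StochasticGraph U V) (x : G.LPVar) (h : V → Option U → ℝ) :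
    G.onlineExp x (fun st d => ∏ v, h v (G.vertexProbe st v (d v))) =
      ∏ v, G.returnExp x v (h v) := by
  have hd : ∀ st : U → V → Bool,
      ∑ d : (v : V) → Option (Tuple U (G.patience v)),
        G.stateProb st * (∏ v, G.drawProb x v (d v)) * ∏ v, h v (G.vertexProbe st v (d v)) =
      G.stateProb st * ∏ v, ∑ o, G.drawProb x v o * h v (G.vertexProbe st v o) := by
    intro st
    rw [Finset.prod_univ_sum, Fintype.piFinset_univ, Finset.mul_sum]
    refine Finset.sum_congr rfl fun d _ => ?_
    rw [Finset.prod_mul_distrib, mul_assoc]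
  rw [onlineExp, Finset.sum_congr rfl fun st _ => hd st]
  have hs : ∀ v, G.returnExp x v (h v) = ∑ s : U → Bool,
      (∏ u, if s u then G.p u v else 1 - G.p u v) *
        ∑ o, G.drawProb x v o * h v (o.bind fun t => t.1.find? s) := by
    intro v
    simp only [returnExp, bernoulliExp, Finset.mul_sum]
    rw [Finset.sum_comm]
    exact Finset.sum_congr rfl fun _ _ => Finset.sum_congr rfl fun _ _ => mul_left_comm _ _ _
  rw [Finset.prod_congr rfl fun v _ => hs v, Finset.prod_univ_sum, Fintype.piFinset_univ]
  -- Transposing the states groups the edges by online vertex: the result at `v` depends only on the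
  -- column of `v`, so the sum factors.
  refine Fintype.sum_equiv (Equiv.piComm fun _ _ => Bool) _ _ fun st => ?_
  rw [Finset.prod_mul_distrib, stateProb, Finset.prod_comm]
  rfl

/-- The product formula is applied to indicators on `S` and to the constant 1 elsewhere. -/
theorem onlineExp_returned (G : StochasticGraph U V) (x : G.LPVar) (S : Finset V) (u : U) :
    G.onlineExp x (fun st d => if ∀ v ∈ S, G.vertexProbe st v (d v) = some u then 1 else 0) =
      ∏ v ∈ S, G.marginal x v u := by
  have h := G.onlineExp_prod x (fun v o => if v ∈ S then (if o = some u then 1 else 0) else 1)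
  have hl : ∀ (st : U → V → Bool) (d : (v : V) → Option (Tuple U (G.patience v))),
      (∏ v, if v ∈ S then (if G.vertexProbe st v (d v) = some u then (1 : ℝ) else 0) else 1) =
        if ∀ v ∈ S, G.vertexProbe st v (d v) = some u then 1 else 0 := by
    intro st d
    rw [Finset.prod_ite_mem, Finset.univ_inter, Finset.prod_ite_zero]
    simp
  simp only [hl] at h
  rw [h, ← Finset.univ_inter S, ← Finset.prod_ite_mem, Finset.univ_inter]
  refine Finset.prod_congr rfl fun v _ => ?_
  by_cases hv : v ∈ S
  · simp only [hv, if_true, returnExp_eq_marginal]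
  · simp only [hv, if_false, returnExp_one]

theorem onlineExp_returned_one (G : StochasticGraph U V) (x : G.LPVar) (v : V) (u : U) :
    G.onlineExp x (fun st d => if G.vertexProbe st v (d v) = some u then 1 else 0) =
      G.marginal x v u := by
  simpa using G.onlineExp_returned x {v} u

theorem onlineExp_returned_two (G : StochasticGraph U V) (x : G.LPVar) {v v' : V} (h : v' ≠ v)
    (u : U) :
    G.onlineExp x (fun st d => if G.vertexProbe st v (d v) = some u ∧
      G.vertexProbe st v' (d v') = some u then 1 else 0) =
      G.marginal x v u * G.marginal x v' u := by
  simpa [Finset.prod_pair h.symm] using G.onlineExp_returned x {v, v'} u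

/-- The probability that the online algorithm matches `v` to `u`. -/
noncomputable def romMatchProb (G : StochasticGraph U V) (x : G.LPVar) (v : V) (u : U) : ℝ :=
  (∑ π : Fin (Fintype.card V) ≃ V, G.onlineExp x (fun st d =>
    if G.onlineMatching π st d v = some u then 1 else 0)) /
      (Fintype.card (Fin (Fintype.card V) ≃ V) : ℝ)

theorem romExpectedValue_eq_sum (G : StochasticGraph U V) (x : G.LPVar) :
    G.romExpectedValue x = ∑ v, ∑ u, G.w u v * G.romMatchProb x v u := by
  have h : ∀ π : Fin (Fintype.card V) ≃ V,
      G.onlineExp x (fun st d => G.matchingValue (G.onlineMatching π st d)) =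
        ∑ v, ∑ u, G.w u v * G.onlineExp x (fun st d =>
          if G.onlineMatching π st d v = some u then 1 else 0) := by
    intro π
    simp only [matchingValue_eq_sum, onlineExp_sum, onlineExp_const_mul]
  change (∑ π : Fin (Fintype.card V) ≃ V,
    G.onlineExp x (fun st d => G.matchingValue (G.onlineMatching π st d))) / _ = _
  simp only [h, romMatchProb, ← mul_div_assoc, ← Finset.sum_div]
  congr 1
  rw [Finset.sum_comm]
  refine Finset.sum_congr rfl fun v _ => ?_
  rw [Finset.sum_comm]
  exact Finset.sum_congr rfl fun u _ => (Finset.mul_sum _ _ _).symm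

theorem card_order_pos : (0 : ℝ) < (Fintype.card (Fin (Fintype.card V) ≃ V) : ℝ) := by
  have : Nonempty (Fin (Fintype.card V) ≃ V) := ⟨(Fintype.equivFin V).symm⟩
  exact_mod_cast Fintype.card_pos

/-- Averaging the union bound over orders gives each competitor the factor 1/2, and the offline
constraint bounds the total competition by 1. -/
theorem LPFeasible.romMatchProb_ge {G : StochasticGraph U V} {x : G.LPVar} (hx : G.LPFeasible x)
    (v : V) (u : U) : 1 / 2 * G.marginal x v u ≤ G.romMatchProb x v u := by
  have hπ : ∀ π : Fin (Fintype.card V) ≃ V,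
      G.marginal x v u - ∑ v' ∈ Finset.univ.erase v,
        (if π.symm v' < π.symm v then 1 else 0) * (G.marginal x v u * G.marginal x v' u) ≤
      G.onlineExp x (fun st d => if G.onlineMatching π st d v = some u then 1 else 0) := by
    intro π
    refine le_trans (le_of_eq ?_) (onlineExp_mono hx fun st d =>
      greedyMatching_lower (fun v => G.vertexProbe st v (d v)) π v u)
    simp only [onlineExp_sub, onlineExp_sum, onlineExp_const_mul, onlineExp_returned_one]
    congr 1
    exact Finset.sum_congr rfl fun v' hv' => by
      rw [onlineExp_returned_two G x (Finset.ne_of_mem_erase hv')]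
  have hsum := Finset.sum_le_sum fun π (_ : π ∈ Finset.univ) => hπ π
  rw [romMatchProb, le_div_iff₀ card_order_pos]
  refine le_trans ?_ hsum
  rw [Finset.sum_sub_distrib, Finset.sum_comm, Finset.sum_const, Finset.card_univ, nsmul_eq_mul]
  have hv' : ∀ v' ∈ Finset.univ.erase v, (∑ π : Fin (Fintype.card V) ≃ V,
      (if π.symm v' < π.symm v then 1 else 0) * (G.marginal x v u * G.marginal x v' u)) =
      1 / 2 * (Fintype.card (Fin (Fintype.card V) ≃ V) : ℝ) * G.marginal x v u *
        G.marginal x v' u := fun v' h => by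
    rw [← Finset.sum_mul, Fintype.sum_equiv_lt (Finset.ne_of_mem_erase h)]
    ring
  rw [Finset.sum_congr rfl hv', ← Finset.mul_sum]
  have hle : ∑ v' ∈ Finset.univ.erase v, G.marginal x v' u ≤ 1 :=
    (Finset.sum_le_sum_of_subset_of_nonneg (Finset.erase_subset v Finset.univ)
      fun v' _ _ => hx.marginal_nonneg v' u).trans (hx.sum_marginal_le_one u)
  have hc := mul_le_mul_of_nonneg_left hle
    (mul_nonneg (mul_nonneg (by norm_num : (0 : ℝ) ≤ 1 / 2) (card_order_pos (V := V)).le)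
      (hx.marginal_nonneg v u))
  linarith

theorem LPFeasible.romMatchProb_le_sub {G : StochasticGraph U V} {x : G.LPVar}
    (hx : G.LPFeasible x) {v v' : V} (h : v' ≠ v) (u : U) :
    G.romMatchProb x v u ≤ G.marginal x v u * (1 - 1 / 2 * G.marginal x v' u) := by
  have hπ : ∀ π : Fin (Fintype.card V) ≃ V,
      G.onlineExp x (fun st d => if G.onlineMatching π st d v = some u then 1 else 0) ≤
        G.marginal x v u - (if π.symm v' < π.symm v then 1 else 0) *
          (G.marginal x v u * G.marginal x v' u) := by
    intro π
    refine (onlineExp_mono hx fun st d =>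
      greedyMatching_upper (fun v => G.vertexProbe st v (d v)) π v v' u).trans_eq ?_
    rw [onlineExp_sub, onlineExp_const_mul, onlineExp_returned_one, onlineExp_returned_two G x h]
  have hsum := Finset.sum_le_sum fun π (_ : π ∈ Finset.univ) => hπ π
  rw [romMatchProb, div_le_iff₀ card_order_pos]
  refine hsum.trans_eq ?_
  rw [Finset.sum_sub_distrib, ← Finset.sum_mul, Fintype.sum_equiv_lt h, Finset.sum_const,
    Finset.card_univ, nsmul_eq_mul]
  ring

theorem LPFeasible.romMatchProb_le {G : StochasticGraph U V} {x : G.LPVar}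
    (hx : G.LPFeasible x) (v : V) (u : U) : G.romMatchProb x v u ≤ G.marginal x v u := by
  have hπ : ∀ π : Fin (Fintype.card V) ≃ V,
      G.onlineExp x (fun st d => if G.onlineMatching π st d v = some u then 1 else 0) ≤
        G.marginal x v u := by
    intro π
    rw [← onlineExp_returned_one]
    refine onlineExp_mono hx fun st d => ?_
    by_cases h : G.onlineMatching π st d v = some u
    · have hR : G.vertexProbe st v (d v) = some u :=
        eq_some_of_greedyMatching (R := fun v => G.vertexProbe st v (d v)) h
      rw [if_pos h, if_pos hR]
    · rw [if_neg h]
      positivity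
  rw [romMatchProb, div_le_iff₀ card_order_pos]
  refine (Finset.sum_le_sum fun π (_ : π ∈ Finset.univ) => hπ π).trans_eq ?_
  rw [Finset.sum_const, Finset.card_univ, nsmul_eq_mul, mul_comm]

/-- The online algorithm attains half of the benchmark. -/
theorem LPOptimal.half_OPT_le {G : StochasticGraph U V} {x : G.LPVar} (hx : G.LPOptimal x) :
    1 / 2 * G.OPT ≤ G.romExpectedValue x := by
  refine (mul_le_mul_of_nonneg_left hx.OPT_le (by norm_num)).trans ?_
  rw [romExpectedValue_eq_sum, Finset.mul_sum]
  refine Finset.sum_le_sum fun v _ => ?_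
  rw [Finset.mul_sum]
  refine Finset.sum_le_sum fun u _ => ?_
  rw [mul_left_comm]
  rcases le_or_gt 0 (G.w u v) with hw | hw
  · exact mul_le_mul_of_nonneg_left (hx.1.romMatchProb_ge v u) hw
  -- For a negative weight a lower bound on the matching probability would point the wrong way;
  -- instead, both sides are controlled by the vanishing marginal.
  · have h := hx.marginal_eq_zero hw
    rw [h, mul_zero, mul_zero]
    exact mul_nonneg_of_nonpos_of_nonpos hw.le ((hx.1.romMatchProb_le v u).trans_eq h)

end StochasticGraph

/-! ### Tightness -/

/-- One offline vertex and two online vertices: an edge of small weight that is always active, and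
an edge of weight `1` that is active with probability `ε`. -/
def tightGraph (ε : ℝ) (h0 : 0 ≤ ε) (h1 : ε ≤ 1) : StochasticGraph (Fin 1) (Fin 2) where
  p _ v := if v = 0 then 1 else ε
  w _ v := if v = 0 then ε ^ 2 else 1
  patience _ := 1
  p_nonneg _ v := by split_ifs <;> linarith
  p_le_one _ v := by split_ifs <;> linarith

section Tight

open StochasticGraph

variable {ε : ℝ} {h0 : 0 ≤ ε} {h1 : ε ≤ 1}

/-- It suffices to ignore the certain edge and probe only the valuable one. -/
theorem le_OPT_tightGraph : ε ≤ (tightGraph ε h0 h1).OPT := by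
  set A : ProbingAlgorithm (Fin 1) (Fin 2) := .probe 0 1 .halt .halt with hA
  have hrp : (tightGraph ε h0 h1).RespectsPatience A := by
    intro v
    fin_cases v <;> simp [hA, ProbingAlgorithm.maxProbes, tightGraph]
  refine le_trans (le_of_eq ?_)
    (le_ciSup (tightGraph ε h0 h1).bddAbove_expectedValue ⟨A, hrp⟩)
  have := bernoulliExp_reveal (fun e : Fin 1 × Fin 2 => (tightGraph ε h0 h1).p e.1 e.2) (0, 1)
    (f := fun s => (tightGraph ε h0 h1).runValue (fun a b => s (a, b)) A (fun _ => none))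
    (f₁ := fun _ => 1) (f₀ := fun _ => 0)
    (fun s hs => by
      simp [hA, runValue, hs, matchingValue, addEdge, tightGraph, Fin.sum_univ_two])
    (fun s hs => by simp [hA, runValue, hs, matchingValue])
  simp only [expectedValue_eq_bernoulliExp, this, bernoulliExp_const]
  simp [tightGraph]

/-- The marginals `1 - ε` and `ε` exactly exhaust the offline capacity. An optimal solution does at
least as well while its second marginal is at most `ε`, so its first cannot fall below `1 - ε`. -/
theorem one_sub_le_marginal_tightGraph (hε : 0 < ε) {x : (tightGraph ε h0 h1).LPVar}
    (hx : (tightGraph ε h0 h1).LPOptimal x) :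
    1 - ε ≤ (tightGraph ε h0 h1).marginal x 0 0 := by
  set z : Fin 2 → Fin 1 → ℝ := fun v _ => if v = 0 then 1 - ε else ε with hz
  have hmem : ∀ v, z v ∈ marginalPolytope (fun u => (tightGraph ε h0 h1).p u v) Set.univ
      ((tightGraph ε h0 h1).patience v) := by
    have hv : ∀ v, vertexMarginal (fun u => (tightGraph ε h0 h1).p u v) [0] ∈
        marginalPolytope (fun u => (tightGraph ε h0 h1).p u v) Set.univ
          ((tightGraph ε h0 h1).patience v) :=
      fun v => vertexMarginal_mem (by simp) (by simp) le_rfl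
    refine Fin.forall_fin_two.2 ⟨?_, ?_⟩
    · convert convex_marginalPolytope (hv 0) zero_mem_marginalPolytope
        (sub_nonneg.2 h1) h0 (by ring) using 1
      ext u
      fin_cases u
      simp [vertexMarginal, tightGraph, hz]
    · convert hv 1 using 1
      ext u
      fin_cases u
      simp [vertexMarginal, tightGraph, hz]
  have h := hx.sum_le hmem (by intro u; simp [hz, Fin.sum_univ_two])
  have hle := hx.1.marginal_le 1 0
  simp only [Fin.sum_univ_two, Fin.sum_univ_one, hz, tightGraph, if_true, one_ne_zero,
    if_false, one_mul] at h hle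
  have hsq : 0 < ε ^ 2 := by positivity
  exact le_of_mul_le_mul_left (by simp only [tightGraph]; linarith) hsq

theorem romExpectedValue_tightGraph_le (hε : 0 < ε) {x : (tightGraph ε h0 h1).LPVar}
    (hx : (tightGraph ε h0 h1).LPOptimal x) :
    (tightGraph ε h0 h1).romExpectedValue x ≤ ε * (1 / 2 + 3 / 2 * ε) := by
  have hz0 := one_sub_le_marginal_tightGraph hε hx
  have hz0' := hx.1.marginal_le 0 0
  have hz1 := hx.1.marginal_le 1 0
  have hz1' := hx.1.marginal_nonneg 1 0
  have hr0 := hx.1.romMatchProb_le 0 0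
  have hr1 := hx.1.romMatchProb_le_sub (v := 1) (v' := 0) (by decide) 0
  rw [romExpectedValue_eq_sum]
  generalize (tightGraph ε h0 h1).marginal x 0 0 = a at *
  generalize (tightGraph ε h0 h1).marginal x 1 0 = b at *
  generalize (tightGraph ε h0 h1).romMatchProb x = r at *
  simp only [Fin.sum_univ_two, Fin.sum_univ_one, tightGraph, if_true, one_ne_zero,
    if_false, one_mul] at *
  -- The certain edge contributes at most `ε ^ 2`, of lower order than `ε`; the other one is blocked
  -- with probability at least `(1 - ε) / 2`.
  have e1 : ε ^ 2 * r 0 0 ≤ ε ^ 2 * 1 := mul_le_mul_of_nonneg_left (hr0.trans hz0') (sq_nonneg ε)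
  have e2 : b * (1 - 1 / 2 * a) ≤ b * (1 / 2 + 1 / 2 * ε) :=
    mul_le_mul_of_nonneg_left (by linarith) hz1'
  have e3 : b * (1 / 2 + 1 / 2 * ε) ≤ ε * (1 / 2 + 1 / 2 * ε) :=
    mul_le_mul_of_nonneg_right hz1 (by linarith)
  linarith

end Tight

theorem theorem3p2 :
    (∀ (U V : Type*) [Fintype U] [DecidableEq U] [Fintype V] [DecidableEq V]
      (G : StochasticGraph U V) (x : G.LPVar), G.LPOptimal x →
        1 / 2 * G.OPT ≤ G.romExpectedValue x) ∧
    (∀ c : ℝ, 1 / 2 < c →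
      ∃ G : StochasticGraph (Fin 1) (Fin 2),
        (∀ u v, 0 ≤ G.w u v) ∧ 0 < G.OPT ∧
        ∀ x : G.LPVar, G.LPOptimal x → G.romExpectedValue x < c * G.OPT) := by
  refine ⟨fun U V _ _ _ _ G x hx => hx.half_OPT_le, fun c hc => ?_⟩
  obtain ⟨ε, hε, h1, hεc⟩ : ∃ ε : ℝ, 0 < ε ∧ ε ≤ 1 ∧ 1 / 2 + 3 / 2 * ε < c := by
    -- With this choice `3 / 2 * ε` is at most three quarters of the gap `c - 1 / 2`.
    refine ⟨min 1 ((c - 1 / 2) / 2), lt_min one_pos (by linarith), min_le_left _ _, ?_⟩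
    linarith [min_le_right 1 ((c - 1 / 2) / 2)]
  have hOPT : ε ≤ (tightGraph ε hε.le h1).OPT := le_OPT_tightGraph
  refine ⟨tightGraph ε hε.le h1, fun u v => ?_, hε.trans_le hOPT, fun x hx => ?_⟩
  · simp only [tightGraph]
    split_ifs <;> positivity
  · calc (tightGraph ε hε.le h1).romExpectedValue x ≤ ε * (1 / 2 + 3 / 2 * ε) :=
          romExpectedValue_tightGraph_le hε hx
      _ < ε * c := mul_lt_mul_of_pos_left hεc hε
      _ = c * ε := mul_comm _ _
      _ ≤ c * (tightGraph ε hε.le h1).OPT := mul_le_mul_of_nonneg_left hOPT (by linarith)
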